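/- **Definitions.** For a totally ordered abelian group $\mathcal G$ (written multiplicatively, order $\ll$), finitely many elements $\mu_1,\dots,\mu_M\ll 1$ and $\mathbf k_0\in\mathbb Z^M$, consider the formal series with real coefficients $\sum_{\mathbf k\ge \mathbf k_0}c_{\mathbf k}\mu^{\mathbf k}$, $\mu^{\mathbf k}=\mu_1^{k_1}\cdots\mu_M^{k_M}$, two series being identified if they have the same coefficient at every element of $\mathcal G$. Such a series is said to be generated by $\mu_1,\dots,\mu_M$. All these series, for all choices of $M$, $\mu_i$ and $\mathbf k_0$, with termwise addition and the convolution product, form the ring $S(\mathcal G)$ of finitely generated series. A nonzero series is positive if the coefficient of its largest monomial is positive, and it is large if all its monomials are $\gg1$. A family of series has an asymptotic sum if all its members are series in the same $\mu_1,\dots,\mu_M$ with the same $\mathbf k_0$ and every monomial receives only finitely many nonzero contributions; the sum is then taken coefficientwise. Let $\mathcal G^{[0]}=\{x^\sigma:\sigma\in\mathbb R\}$ with $x^{\sigma}\ll x^{\tau}$ iff $\sigma<\tau$, and $\mathcal T^{[n]}=S(\mathcal G^{[n]})$. Let $\mathcal G^{[n+1]}$ be the group of formal expressions $x^\sigma e^{L}$,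 where $\sigma\in\mathbb R$ and $L\in\mathcal T^{[n]}$ is large or zero, with $x^{\sigma_1}e^{L_1}\,x^{\sigma_2}e^{L_2}=x^{\sigma_1+\sigma_2}e^{L_1+L_2}$, and $x^{\sigma_1}e^{L_1}\gg x^{\sigma_2}e^{L_2}$ iff $L_1>L_2$, or $L_1=L_2$ and $\sigma_1>\sigma_2$. Identifying $x^\sigma$ with $x^\sigma e^0$, one has natural embeddings $\mathcal G^{[n]}\subset\mathcal G^{[n+1]}$ and $\mathcal T^{[n]}\subset\mathcal T^{[n+1]}$; let $\mathcal T=\bigcup_n\mathcal T^{[n]}$ be the (direct limit) ring of log-free transseries. A finite set $B$ of elements $\ll1$ of $\mathcal G^{[n]}$ is a generating system (in all levels) of $f\in\mathcal T^{[n]}$ if $f$ is generated by $B$ and, when $n\ge1$, for every $x^\sigma e^{L}\in B$ with $L\neq0$ some subset of $B\cap\mathcal G^{[n-1]}$ is a generating system of $L\in\mathcal T^{[n-1]}$. **Proposition.** Every $\mathcal T^{[n]}$, $n=0,1,2,\dots$, and $\mathcal T$ are fields. There are derivations $\mathcal D:\mathcal T^{[n]}\to\mathcal T^{[n]}$, $n=0,1,2,\dots$,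 $\mathbb R$-linear and satisfying the Leibniz rule, such that 1. $\mathcal D x^\sigma=\sigma x^{\sigma-1}$ in $\mathcal T^{[0]}$, and $\mathcal D(x^\sigma e^L)=\sigma x^{\sigma-1}e^L+(\mathcal DL)\,x^\sigma e^L$ in $\mathcal T^{[n+1]}$, for all $\sigma\in\mathbb R$ and all $L\in\mathcal T^{[n]}$ large or zero; 2. differentiation is term by term: for $f=\sum_{m\in\mathcal G^{[n]}} c_m m\in\mathcal T^{[n]}$, the family $(c_m\mathcal Dm)_m$ has the asymptotic sum $\mathcal Df$. The maps $\mathcal D$ are the only family of maps $\mathcal T^{[n]}\to\mathcal T^{[n]}$ with properties 1 and 2; they are compatible with the embeddings $\mathcal T^{[n]}\subset\mathcal T^{[n+1]}$, and there is exactly one derivation of $\mathcal T$ that restricts to $\mathcal D$ on every $\mathcal T^{[n]}$. Thus the $\mathcal T^{[n]}$ and $\mathcal T$ are differential fields. Moreover, for $f\in\mathcal T^{[n]}$, every finite set of elements $\ll1$ of $\mathcal G^{[n]}$ that generates $f$ is contained in a generating system of $f$; and if $B$ is a generating system of $f$, then $B\cup\{x^{-1}\}$ is a generating system of $\mathcal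 Df$. -/

import Mathlib

namespace Transseries

noncomputable section

/-! ### Finitely generated formal series over a totally ordered abelian group

A totally ordered abelian group of monomials is written additively with the order reversed:
`g < h` in `Γ` means that the monomial `g` is asymptotically larger than the monomial `h`, so the
monomials `≪ 1` are the `g > 0` and `μ ^ k` is `k • μ`.
Formal series are Hahn series with real coefficients. -/

set_option linter.unusedSectionVars false

section Series

variable {Γ : Type} [AddCommGroup Γ] [LinearOrder Γ] [IsOrderedAddMonoid Γ]

/-- The monomials `∏ μ ^ (k μ)`, `μ` in the finite set `B`, with integer exponents `k ≥ k₀`. -/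
def grid (B : Finset Γ) (k₀ : Γ → ℤ) : Set Γ :=
  {g | ∃ k : Γ → ℤ, (∀ b ∈ B, k₀ b ≤ k b) ∧ g = ∑ b ∈ B, k b • b}

/-- The series `f` has the form `∑_{k ≥ k₀} c_k ∏ μ ^ (k μ)`, `μ` in `B`, for some `k₀`. -/
def GeneratedBy (B : Finset Γ) (f : HahnSeries Γ ℝ) : Prop :=
  ∃ k₀ : Γ → ℤ, f.support ⊆ grid B k₀

/-- The series `f` is generated by finitely many monomials `≪ 1`. -/
def FinitelyGenerated (f : HahnSeries Γ ℝ) : Prop :=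
  ∃ B : Finset Γ, (∀ b ∈ B, 0 < b) ∧ GeneratedBy B f

theorem grid_subset {B B' : Finset Γ} (h : B ⊆ B') (k₀ : Γ → ℤ) :
    grid B k₀ ⊆ grid B' (fun b => min (k₀ b) 0) := by
  classical
  rintro g ⟨k, hk, rfl⟩
  refine ⟨fun b => if b ∈ B then k b else 0, ?_, ?_⟩
  · intro b _
    by_cases hb : b ∈ B
    · simp [hb, hk b hb]
    · simp [hb]
  · rw [← Finset.sum_subset h]
    · exact Finset.sum_congr rfl fun b hb => by simp [hb]
    · intro b _ hb
      simp [hb]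

theorem GeneratedBy.mono {B B' : Finset Γ} (h : B ⊆ B') {f : HahnSeries Γ ℝ}
    (hf : GeneratedBy B f) : GeneratedBy B' f := by
  obtain ⟨k₀, hk⟩ := hf
  exact ⟨_, hk.trans (grid_subset h k₀)⟩

theorem GeneratedBy.add {B : Finset Γ} {f g : HahnSeries Γ ℝ}
    (hf : GeneratedBy B f) (hg : GeneratedBy B g) : GeneratedBy B (f + g) := by
  obtain ⟨k, hk⟩ := hf
  obtain ⟨l, hl⟩ := hg
  refine ⟨fun b => min (k b) (l b), fun x hx => ?_⟩
  have hx' : x ∈ f.support ∪ g.support := by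
    by_contra h
    simp only [Set.mem_union, HahnSeries.mem_support, not_or, not_not] at h
    exact hx (by simp [h.1, h.2])
  rcases hx' with h | h
  · obtain ⟨m, hm, rfl⟩ := hk h
    exact ⟨m, fun b hb => (min_le_left _ _).trans (hm b hb), rfl⟩
  · obtain ⟨m, hm, rfl⟩ := hl h
    exact ⟨m, fun b hb => (min_le_right _ _).trans (hm b hb), rfl⟩

theorem GeneratedBy.mul {B : Finset Γ} {f g : HahnSeries Γ ℝ}
    (hf : GeneratedBy B f) (hg : GeneratedBy B g) : GeneratedBy B (f * g) := by
  obtain ⟨k, hk⟩ := hf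
  obtain ⟨l, hl⟩ := hg
  refine ⟨fun b => k b + l b, fun x hx => ?_⟩
  obtain ⟨y, hy, z, hz, rfl⟩ := HahnSeries.support_mul_subset hx
  obtain ⟨m, hm, rfl⟩ := hk hy
  obtain ⟨m', hm', rfl⟩ := hl hz
  refine ⟨fun b => m b + m' b, fun b hb => add_le_add (hm b hb) (hm' b hb), ?_⟩
  simp [add_smul, Finset.sum_add_distrib]

theorem FinitelyGenerated.common {f g : HahnSeries Γ ℝ}
    (hf : FinitelyGenerated f) (hg : FinitelyGenerated g) :
    ∃ B : Finset Γ, (∀ b ∈ B, 0 < b) ∧ GeneratedBy B f ∧ GeneratedBy B g := by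
  obtain ⟨B, hB, hf⟩ := hf
  obtain ⟨B', hB', hg⟩ := hg
  refine ⟨B ∪ B', fun b hb => ?_, hf.mono Finset.subset_union_left,
    hg.mono Finset.subset_union_right⟩
  rcases Finset.mem_union.mp hb with h | h
  exacts [hB b h, hB' b h]

theorem finitelyGenerated_single (g : Γ) (c : ℝ) :
    FinitelyGenerated (HahnSeries.single g c) := by
  have hs : (HahnSeries.single g c).support ⊆ {g} := HahnSeries.support_single_subset
  rcases lt_trichotomy g 0 with h | h | h
  · refine ⟨{-g}, by simpa using h, fun _ => -1, hs.trans ?_⟩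
    rintro x rfl
    exact ⟨fun _ => -1, by simp, by simp⟩
  · refine ⟨∅, by simp, fun _ => 0, hs.trans ?_⟩
    rintro x rfl
    exact ⟨fun _ => 0, by simp, by simp [h]⟩
  · refine ⟨{g}, by simpa using h, fun _ => 1, hs.trans ?_⟩
    rintro x rfl
    exact ⟨fun _ => 1, by simp, by simp⟩

variable (Γ) in
/-- The algebra of all finitely generated formal series, as a subalgebra of the Hahn series. -/
def finGen : Subalgebra ℝ (HahnSeries Γ ℝ) where
  carrier := {f | FinitelyGenerated f}
  mul_mem' hf hg := by
    obtain ⟨B, hB, hf, hg⟩ := FinitelyGenerated.common hf hg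
    exact ⟨B, hB, hf.mul hg⟩
  add_mem' hf hg := by
    obtain ⟨B, hB, hf, hg⟩ := FinitelyGenerated.common hf hg
    exact ⟨B, hB, hf.add hg⟩
  algebraMap_mem' r := by
    have h : algebraMap ℝ (HahnSeries Γ ℝ) r = HahnSeries.single 0 r := by
      simp [HahnSeries.algebraMap_apply, HahnSeries.C_apply]
    rw [h]
    exact finitelyGenerated_single 0 r

/-- The monomial `g` as a formal series. -/
def monomialSeries (g : Γ) : finGen Γ :=
  ⟨HahnSeries.single g 1, finitelyGenerated_single g 1⟩

/-- The additive group of large series: finitely generated series all of whose monomials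
are `≫ 1`. The order inherited from `Lex` is the one in which a nonzero series is positive
if and only if the coefficient of its dominant monomial is positive. -/
def large (Γ : Type) [AddCommGroup Γ] [LinearOrder Γ] [IsOrderedAddMonoid Γ] :
    AddSubgroup (Lex (HahnSeries Γ ℝ)) where
  carrier := {f | ofLex f ∈ finGen Γ ∧ ∀ g : Γ, (ofLex f).coeff g ≠ 0 → g < 0}
  zero_mem' := ⟨(finGen Γ).zero_mem, by simp⟩
  add_mem' := by
    rintro f g ⟨hf, hf'⟩ ⟨hg, hg'⟩
    refine ⟨(finGen Γ).add_mem hf hg, fun x hx => ?_⟩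
    by_cases h : (ofLex f).coeff x = 0
    · refine hg' x fun h' => hx ?_
      simp [h, h']
    · exact hf' x h
  neg_mem' := by
    rintro f ⟨hf, hf'⟩
    refine ⟨(finGen Γ).neg_mem hf, fun x hx => hf' x fun h => hx ?_⟩
    simp [h]

/-- A large series as a finitely generated series. -/
def largeToSeries (L : large Γ) : finGen Γ := ⟨ofLex (L : Lex (HahnSeries Γ ℝ)), L.2.1⟩

/-- `f = ∑ᵢ s i` in the asymptotic topology: all the `s i` have their monomials in one
set `{∏ μ ^ (k μ) : k ≥ k₀}` with finitely many generators `μ ≪ 1`, and each monomial receives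
only finitely many nonzero contributions, which add up to its coefficient in `f`. -/
def IsAsymptoticSum {I : Type} (s : I → finGen Γ) (f : finGen Γ) : Prop :=
  (∃ (B : Finset Γ) (k₀ : Γ → ℤ), (∀ b ∈ B, 0 < b) ∧
    ∀ i, (s i : HahnSeries Γ ℝ).support ⊆ grid B k₀) ∧
  ∀ g : Γ, {i | (s i : HahnSeries Γ ℝ).coeff g ≠ 0}.Finite ∧
    (f : HahnSeries Γ ℝ).coeff g = ∑ᶠ i, (s i : HahnSeries Γ ℝ).coeff g

/-! ### Functoriality in the monomial group -/

variable {Γ' : Type} [AddCommGroup Γ'] [LinearOrder Γ'] [IsOrderedAddMonoid Γ']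

/-- An injective monotone homomorphism is an order embedding. -/
def orderEmb (e : Γ →+o Γ') (he : Function.Injective e) : Γ ↪o Γ' :=
  OrderEmbedding.ofStrictMono e (e.monotone'.strictMono_of_injective he)

theorem FinitelyGenerated.embDomain (e : Γ →+o Γ') (he : Function.Injective e)
    {f : HahnSeries Γ ℝ} (hf : FinitelyGenerated f) :
    FinitelyGenerated (HahnSeries.embDomain (orderEmb e he) f) := by
  classical
  obtain ⟨B, hB, k₀, hk⟩ := hf
  refine ⟨B.image e, ?_, Function.extend e k₀ 0, ?_⟩
  · intro b hb
    obtain ⟨a, ha, rfl⟩ := Finset.mem_image.mp hb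
    have := (e.monotone'.strictMono_of_injective he) (hB a ha)
    simpa using this
  · refine HahnSeries.support_embDomain_subset.trans ?_
    rintro _ ⟨g, hg, rfl⟩
    obtain ⟨k, hk', rfl⟩ := hk hg
    refine ⟨Function.extend e k 0, ?_, ?_⟩
    · intro b hb
      obtain ⟨a, ha, rfl⟩ := Finset.mem_image.mp hb
      simpa [he.extend_apply] using hk' a ha
    · rw [Finset.sum_image fun _ _ _ _ h => he h]
      change e _ = _
      rw [map_sum]
      exact Finset.sum_congr rfl fun a _ => by rw [he.extend_apply, map_zsmul]

/-- The embedding of series induced by an embedding of monomial groups. -/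
def finGenMap (e : Γ →+o Γ') (he : Function.Injective e) : finGen Γ →ₐ[ℝ] finGen Γ' :=
  ((HahnSeries.embDomainAlgHom e.toAddMonoidHom he
      (fun _ _ => (orderEmb e he).le_iff_le)).comp (finGen Γ).val).codRestrict (finGen Γ')
    fun f => f.2.embDomain e he

/-- The embedding of large series induced by an embedding of monomial groups. -/
def largeMap (e : Γ →+o Γ') (he : Function.Injective e) : large Γ →+ large Γ' :=
  ((HahnSeries.embDomainOrderAddMonoidHom (R := ℝ)
      (orderEmb e he)).toAddMonoidHom.comp (large Γ).subtype).codRestrict (large Γ') <| by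
    rintro ⟨f, hf, hf'⟩
    refine ⟨hf.embDomain e he, fun g hg => ?_⟩
    obtain ⟨a, ha, rfl⟩ := HahnSeries.support_embDomain_subset (f := orderEmb e he) hg
    have := (e.monotone'.strictMono_of_injective he) (hf' a ha)
    exact this.trans_eq (map_zero e)

theorem largeMap_strictMono (e : Γ →+o Γ') (he : Function.Injective e) :
    StrictMono (largeMap e he) := fun _ _ h =>
  (HahnSeries.embDomainOrderEmbedding (R := ℝ) (orderEmb e he)).strictMono h

end Series

section Lex

variable {A B : Type} [AddCommGroup A] [LinearOrder A] [AddCommGroup B] [LinearOrder B]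

/-- The embedding `σ ↦ (0, σ)`. -/
def lexInr (A : Type) [AddCommGroup A] [LinearOrder A] : ℝᵒᵈ →+o (A ×ₗ ℝ)ᵒᵈ where
  toFun σ := OrderDual.toDual (toLex ((0 : A), OrderDual.ofDual σ))
  map_zero' := rfl
  map_add' a b := congrArg (fun z : A × ℝ => OrderDual.toDual (toLex z))
    (Prod.ext (add_zero (0 : A)).symm rfl)
  monotone' a b h := by
    apply OrderDual.toDual_le_toDual.mpr
    exact Prod.Lex.toLex_le_toLex.mpr (Or.inr ⟨rfl, h⟩)

theorem lexInr_injective (A : Type) [AddCommGroup A] [LinearOrder A] :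
    Function.Injective (lexInr A) := fun _ _ h =>
  congrArg (fun z : (A ×ₗ ℝ)ᵒᵈ => OrderDual.toDual (ofLex (OrderDual.ofDual z)).2) h

/-- The map `(a, σ) ↦ (f a, σ)`. -/
def lexMap (f : A →+ B) (hf : StrictMono f) : (A ×ₗ ℝ)ᵒᵈ →+o (B ×ₗ ℝ)ᵒᵈ where
  toFun m := OrderDual.toDual
    (toLex (f (ofLex (OrderDual.ofDual m)).1, (ofLex (OrderDual.ofDual m)).2))
  map_zero' := congrArg (fun z : B × ℝ => OrderDual.toDual (toLex z))
    (Prod.ext (map_zero f) rfl)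
  map_add' a b := congrArg (fun z : B × ℝ => OrderDual.toDual (toLex z))
    (Prod.ext (map_add f _ _) rfl)
  monotone' a b h := by
    apply OrderDual.toDual_le_toDual.mpr
    rcases Prod.Lex.le_iff.mp (OrderDual.ofDual_le_ofDual.mpr h) with h | ⟨h, h'⟩
    · exact Prod.Lex.toLex_le_toLex.mpr (Or.inl (hf h))
    · exact Prod.Lex.toLex_le_toLex.mpr (Or.inr ⟨congrArg f h, h'⟩)

theorem lexMap_injective (f : A →+ B) (hf : StrictMono f) : Function.Injective (lexMap f hf) := by
  intro a b h
  have h' : (f (ofLex (OrderDual.ofDual a)).1, (ofLex (OrderDual.ofDual a)).2) =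
      (f (ofLex (OrderDual.ofDual b)).1, (ofLex (OrderDual.ofDual b)).2) :=
    congrArg (fun z : (B ×ₗ ℝ)ᵒᵈ => ofLex (OrderDual.ofDual z)) h
  have h₁ := hf.injective (congrArg Prod.fst h')
  have h₂ := congrArg Prod.snd h'
  exact congrArg (fun z : A × ℝ => OrderDual.toDual (toLex z)) (Prod.ext h₁ h₂)

theorem lex_lt_iff (a b : A) (σ τ : ℝ) :
    (OrderDual.toDual (toLex (a, σ)) : (A ×ₗ ℝ)ᵒᵈ) < OrderDual.toDual (toLex (b, τ)) ↔
      b < a ∨ b = a ∧ τ < σ :=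
  OrderDual.toDual_lt_toDual.trans Prod.Lex.toLex_lt_toLex

end Lex

/-! ### Transmonomials and transseries of level `n` -/

/-- A totally ordered abelian group. -/
structure MonomialGroup where
  carrier : Type
  [group : AddCommGroup carrier]
  [order : LinearOrder carrier]
  [compat : IsOrderedAddMonoid carrier]

attribute [instance] MonomialGroup.group MonomialGroup.order MonomialGroup.compat

/-- The group of monomials `x ^ σ * exp L` with `σ` real and `L` a large series over `G`;
`(L, σ)` are compared lexicographically (and the order is reversed, as always here). -/
def MonomialGroup.next (G : MonomialGroup) : MonomialGroup where
  carrier := (large G.carrier ×ₗ ℝ)ᵒᵈ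

/-- The transmonomials of level `n`; at level `0` these are the real powers `x ^ σ`. -/
def monomials : ℕ → MonomialGroup
  | 0 => { carrier := ℝᵒᵈ }
  | n + 1 => (monomials n).next

/-- The group of transmonomials of level at most `n`. -/
abbrev Mon (n : ℕ) : Type := (monomials n).carrier

/-- The log-free transseries of level at most `n`. -/
abbrev Trans (n : ℕ) : Type := finGen (Mon n)

/-- The large transseries of level at most `n`, together with `0`. -/
abbrev LargeTrans (n : ℕ) : Type := large (Mon n)

/-- The transmonomial `x ^ σ * exp L` of level `n + 1`. -/
def powExp {n : ℕ} (σ : ℝ) (L : LargeTrans n) : Mon (n + 1) :=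
  OrderDual.toDual (toLex (L, σ) : LargeTrans n ×ₗ ℝ)

/-- The order of the transmonomials: `x ^ σ * exp L ≫ x ^ τ * exp L'` if and only if
`L > L'`, or `L = L'` and `σ > τ`. -/
theorem powExp_lt_powExp {n : ℕ} (σ τ : ℝ) (L L' : LargeTrans n) :
    powExp σ L < powExp τ L' ↔ L' < L ∨ L' = L ∧ τ < σ :=
  lex_lt_iff L L' σ τ

/-- The power `x ^ σ` as a transmonomial of level `n`. -/
def pow : (n : ℕ) → ℝ → Mon n
  | 0, σ => OrderDual.toDual σ
  | _ + 1, σ => powExp σ 0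

/-- An embedding of monomial groups sends `x ^ σ * exp L` to `x ^ σ * exp L'`, where `L'` is
the image of `L`. -/
def MonomialGroup.nextMap {G H : MonomialGroup} (e : G.carrier →+o H.carrier)
    (he : Function.Injective e) : G.next.carrier →+o H.next.carrier :=
  lexMap (largeMap e he) (largeMap_strictMono e he)

/-- The embedding of the transmonomials of level `n` into those of level `n + 1`,
with its injectivity; it sends `x ^ σ` of level `0` to `x ^ σ * exp 0`. -/
def monEmbAux : (n : ℕ) → {e : Mon n →+o Mon (n + 1) // Function.Injective e}
  | 0 => ⟨lexInr (large (Mon 0)), lexInr_injective _⟩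
  | n + 1 => ⟨MonomialGroup.nextMap (monEmbAux n).1 (monEmbAux n).2,
      lexMap_injective _ _⟩

/-- The embedding of the transmonomials of level `n` into those of level `n + 1`. -/
def monEmb (n : ℕ) : Mon n →+o Mon (n + 1) := (monEmbAux n).1

/-- The embedding of the transseries of level `n` into those of level `n + 1`. -/
def emb (n : ℕ) : Trans n →ₐ[ℝ] Trans (n + 1) := finGenMap (monEmb n) (monEmbAux n).2

/-- The embedding of the transseries of level `m` into those of level `n`, for `m ≤ n`. -/
def embLE (m n : ℕ) (h : m ≤ n) : Trans m → Trans n := Nat.leRecOn h fun {k} => emb k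

/-- The ring of general log-free transseries: the union (direct limit) of all the levels. -/
abbrev LogFree : Type := Ring.DirectLimit Trans embLE

/-- The inclusion of the transseries of level `n` into the log-free transseries. -/
def incl (n : ℕ) : Trans n →+* LogFree := Ring.DirectLimit.of Trans embLE n

/-! ### Differentiation and generators -/

/-- `D n`, `n = 0, 1, …`, is the inductively defined term by term differentiation of the
transseries of level `n`. -/
structure IsTermwiseDifferentiation (D : ∀ n, Trans n → Trans n) : Prop where
  /-- `D (x ^ σ) = σ x ^ (σ - 1)` -/
  pow : ∀ σ : ℝ, D 0 (monomialSeries (pow 0 σ)) = σ • monomialSeries (pow 0 (σ - 1))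
  /-- `D (x ^ σ exp L) = σ x ^ (σ - 1) exp L + (D L) x ^ σ exp L` -/
  powExp : ∀ (n : ℕ) (σ : ℝ) (L : LargeTrans n),
    D (n + 1) (monomialSeries (powExp σ L)) =
      σ • monomialSeries (powExp (σ - 1) L) +
        emb n (D n (largeToSeries L)) * monomialSeries (powExp σ L)
  /-- `D (∑ c_m m) = ∑ c_m D m`, the sums being over transmonomials `m` -/
  series : ∀ (n : ℕ) (f : Trans n),
    IsAsymptoticSum (fun m : Mon n => (f : HahnSeries (Mon n) ℝ).coeff m • D n (monomialSeries m))
      (D n f)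

/-- The finite set `B` of small transmonomials contains a set of generators of `f` in all of
the levels: `f` is generated by `B`, and, whenever `x ^ σ * exp L` is in `B` with `L ≠ 0`, the
transseries `L`, of lower level, has in the same sense its generators of all levels in `B`. -/
def IsGeneratingSystem : (n : ℕ) → Trans n → Finset (Mon n) → Prop
  | 0, f, B => (∀ b ∈ B, 0 < b) ∧ GeneratedBy B (f : HahnSeries (Mon 0) ℝ)
  | n + 1, f, B => (∀ b ∈ B, 0 < b) ∧ GeneratedBy B (f : HahnSeries (Mon (n + 1)) ℝ) ∧
      ∀ (σ : ℝ) (L : LargeTrans n), powExp σ L ∈ B → L ≠ 0 →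
        ∃ B' : Finset (Mon n), IsGeneratingSystem n (largeToSeries L) B' ∧ ∀ b ∈ B', monEmb n b ∈ B

end

end Transseries

/-! Fields. A nonzero series is a dominant term times `1 - ε` with `ε` infinitesimal. By Dickson's
lemma the small monomials of a grid lie in a monoid generated by finitely many small monomials, and
the Hahn series inverse of `1 - ε` has its support in that monoid, so it is again finitely
generated. The levels embed injectively into one another, hence the limit is a field as well.

Derivations. Property 1 says that the logarithmic derivative `l m = D m / m` is an additive map from
monomials to series. The monomials of a series generated by `B` lie in the subgroup generated by
`B`, whose image under `l` spans a finite-dimensional real space. With a basis `e i` of it, `l m = ∑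
i, lam i m • e i` for additive real functions `lam i`. Termwise differentiation is therefore the
finite sum of `e i` times the diagonal derivation that multiplies each monomial `m` by `lam i m`.
Summability, linearity, the Leibniz rule and control of the generators all follow from this formula
(`isAsymptoticSum_sum_mul_scaleDerivation`, `choose_eq_sum`).

The logarithmic derivative at level `n + 1` is built from the derivation at level `n`, so the
construction, its uniqueness, its compatibility with the embeddings and the statements on generating
systems are inductions on the level. -/

namespace Transseries

noncomputable section

set_option linter.unusedSectionVars false

section Series

variable {Γ : Type} [AddCommGroup Γ] [LinearOrder Γ] [IsOrderedAddMonoid Γ]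

/-! ### The field of finitely generated series -/

/-- The small monomials in a grid are products of finitely many small monomials. -/
theorem exists_grid_inter_Ioi_subset_closure (B : Finset Γ) (hB : ∀ b ∈ B, 0 < b) (k₀ : Γ → ℤ) :
    ∃ C : Finset Γ, (∀ c ∈ C, 0 < c) ∧
      grid B k₀ ∩ Set.Ioi 0 ⊆ AddSubmonoid.closure (C : Set Γ) := by
  classical
  -- Exponents are counted from `k₀`, so that the grid is parametrized by `ℕ`-valued vectors, where
  -- Dickson's lemma makes the set of minimal vectors with `φ n > 0` finite.
  let φ : (B → ℕ) → Γ := fun n => ∑ b : B, (k₀ b + n b) • (b : Γ)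
  have hfin : {n | Minimal (fun n => 0 < φ n) n}.Finite :=
    WellQuasiOrderedLE.finite_of_isAntichain (setOfPred_minimal_antichain _)
  refine ⟨B ∪ hfin.toFinset.image φ, fun c hc => ?_, ?_⟩
  · rcases Finset.mem_union.mp hc with h | h
    · exact hB c h
    · obtain ⟨n, hn, rfl⟩ := Finset.mem_image.mp h
      exact Minimal.prop (P := fun n => 0 < φ n) (hfin.mem_toFinset.mp hn)
  · rintro _ ⟨⟨k, hk, rfl⟩, hpos⟩
    have hφ : ∑ b ∈ B, k b • b = φ fun b => (k b - k₀ b).toNat := by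
      rw [← Finset.sum_coe_sort]
      refine Finset.sum_congr rfl fun b _ => ?_
      rw [Int.toNat_of_nonneg (sub_nonneg.mpr (hk b b.2)), add_sub_cancel]
    rw [hφ] at hpos ⊢
    -- A vector with small monomial dominates a minimal one `m`; the difference `n - m` only
    -- contributes further factors from `B`.
    obtain ⟨m, hmn, hm⟩ := exists_minimal_le_of_wellFoundedLT (fun n => 0 < φ n) _ hpos
    generalize (fun b : B => (k b - k₀ b).toNat) = n at hmn
    have hsplit : φ n = φ m + ∑ b : B, (n b - m b) • (b : Γ) := by
      rw [← Finset.sum_add_distrib]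
      refine Finset.sum_congr rfl fun b _ => ?_
      rw [← natCast_zsmul, ← add_smul, Nat.cast_sub (hmn b)]
      congr 1
      ring
    rw [hsplit]
    refine add_mem (AddSubmonoid.subset_closure ?_) (sum_mem fun b _ => nsmul_mem
      (AddSubmonoid.subset_closure ?_) _)
    · exact Finset.mem_coe.mpr (Finset.mem_union_right _
        (Finset.mem_image_of_mem _ (hfin.mem_toFinset.mpr hm)))
    · exact Finset.mem_coe.mpr (Finset.mem_union_left _ b.2)

theorem closure_subset_grid (C : Finset Γ) :
    (AddSubmonoid.closure (C : Set Γ) : Set Γ) ⊆ grid C 0 := by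
  intro x hx
  obtain ⟨f, -, rfl⟩ := AddSubmonoid.mem_closure_finset.mp hx
  exact ⟨fun b => f b, fun b _ => by simp, by simp⟩

/-- The support of the inverse of `1 - ε`, for infinitesimal `ε`, consists of products of
monomials of `ε`. -/
theorem support_subset_of_mul_one_sub_eq_one {ε g : HahnSeries Γ ℝ} (M : AddSubmonoid Γ)
    (hM : ε.support ⊆ M) (hpos : ∀ x ∈ ε.support, 0 < x) (h : g * (1 - ε) = 1) :
    g.support ⊆ M := by
  intro a ha
  refine Set.WellFoundedOn.induction g.isWF_support ha fun a ha ih => ?_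
  -- Compare coefficients in `g = 1 + g ε`: a monomial `a ≠ 0` of `g` splits as `q + p` with `q` in
  -- `g` and `p > 0` in `ε`, so `q < a` and the induction applies.
  have ha' : g.coeff a = (1 : HahnSeries Γ ℝ).coeff a + (g * ε).coeff a := by
    rw [← h, ← HahnSeries.coeff_add, mul_sub, mul_one, sub_add_cancel]
  by_cases ha0 : a = 0
  · exact ha0 ▸ M.zero_mem
  · rw [HahnSeries.coeff_one, if_neg ha0, zero_add] at ha'
    obtain ⟨q, hq, p, hp, rfl⟩ := HahnSeries.support_mul_subset (x := g) (y := ε)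
      (a := a) fun h0 => ha (ha'.trans h0)
    exact M.add_mem (ih q hq (lt_add_of_pos_right q (hpos p hp))) (hM hp)

/-- The inverse of a finitely generated series is finitely generated. -/
theorem FinitelyGenerated.inv {f : HahnSeries Γ ℝ} (hf : FinitelyGenerated f) :
    FinitelyGenerated f⁻¹ := by
  by_cases hf0 : f = 0
  · rw [hf0, inv_zero]
    exact (finGen Γ).zero_mem
  -- `u` is the inverse of the dominant term of `f`, so `u * f = 1 - ε` with `ε` infinitesimal.
  set u : HahnSeries Γ ℝ := HahnSeries.single (-f.order) f.leadingCoeff⁻¹ with hu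
  have hlc : f.leadingCoeff ≠ 0 := HahnSeries.leadingCoeff_ne_zero.mpr hf0
  have hu0 : u ≠ 0 := HahnSeries.single_ne_zero (inv_ne_zero hlc)
  have hpos : ∀ x ∈ (1 - u * f).support, 0 < x := by
    intro x hx
    by_contra hle
    apply hx
    have hcoeff : (u * f).coeff x = f.leadingCoeff⁻¹ * f.coeff (x + f.order) := by
      rw [hu, HahnSeries.coeff_single_mul, sub_neg_eq_add]
    rw [HahnSeries.coeff_sub, hcoeff, HahnSeries.coeff_one]
    rcases (not_lt.mp hle).eq_or_lt with rfl | hlt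
    · rw [zero_add, ← HahnSeries.leadingCoeff_eq, inv_mul_cancel₀ hlc]
      simp
    · rw [HahnSeries.coeff_eq_zero_of_lt_order (by simpa using hlt)]
      simp [hlt.ne]
  obtain ⟨B, hB, k₀, hk⟩ : FinitelyGenerated (1 - u * f) :=
    (finGen Γ).sub_mem (finGen Γ).one_mem
      ((finGen Γ).mul_mem (finitelyGenerated_single _ _) hf)
  obtain ⟨C, hC, hsub⟩ := exists_grid_inter_Ioi_subset_closure B hB k₀
  have hinv : FinitelyGenerated (u * f)⁻¹ :=
    ⟨C, hC, 0, (support_subset_of_mul_one_sub_eq_one _ (fun x hx => hsub ⟨hk hx, hpos x hx⟩) hpos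
      (by rw [sub_sub_cancel, inv_mul_cancel₀ (mul_ne_zero hu0 hf0)])).trans
      (closure_subset_grid C)⟩
  have : f⁻¹ = u * (u * f)⁻¹ := by
    rw [mul_inv, mul_inv_cancel_left₀ hu0]
  rw [this]
  exact (finGen Γ).mul_mem (finitelyGenerated_single _ _) hinv

theorem isField_finGen : IsField (finGen Γ) where
  exists_pair_ne := ⟨0, 1, zero_ne_one⟩
  mul_comm := mul_comm
  mul_inv_cancel {f} hf := ⟨⟨_, FinitelyGenerated.inv f.2⟩,
    Subtype.ext (mul_inv_cancel₀ fun h => hf (Subtype.ext h))⟩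

end Series

/-! ### The direct limit of the levels -/

theorem finGenMap_injective {Γ Γ' : Type} [AddCommGroup Γ] [LinearOrder Γ] [IsOrderedAddMonoid Γ]
    [AddCommGroup Γ'] [LinearOrder Γ'] [IsOrderedAddMonoid Γ'] (e : Γ →+o Γ')
    (he : Function.Injective e) : Function.Injective (finGenMap e he) := fun _ _ h =>
  Subtype.ext (HahnSeries.embDomain_injective (congrArg Subtype.val h))

theorem embLE_self (n : ℕ) (f : Trans n) : embLE n n le_rfl f = f := Nat.leRecOn_self f

theorem embLE_succ {m n : ℕ} (h : m ≤ n) (f : Trans m) :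
    embLE m (n + 1) (h.trans n.le_succ) f = emb n (embLE m n h f) := Nat.leRecOn_succ h f

theorem embLE_injective {m n : ℕ} (h : m ≤ n) : Function.Injective (embLE m n h) :=
  Nat.leRecOn_injective h _ fun _ => finGenMap_injective _ _

/-- `embLE` as a ring homomorphism. -/
def embLERingHom (m n : ℕ) (h : m ≤ n) : Trans m →+* Trans n where
  toFun := embLE m n h
  map_zero' := by induction n, h using Nat.le_induction with
    | base => exact embLE_self _ _
    | succ n h ih => rw [embLE_succ h, ih, map_zero]
  map_one' := by induction n, h using Nat.le_induction with
    | base => exact embLE_self _ _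
    | succ n h ih => rw [embLE_succ h, ih, map_one]
  map_add' f g := by induction n, h using Nat.le_induction with
    | base => simp only [embLE_self]
    | succ n h ih => simp only [embLE_succ h, ih, map_add]
  map_mul' f g := by induction n, h using Nat.le_induction with
    | base => simp only [embLE_self]
    | succ n h ih => simp only [embLE_succ h, ih, map_mul]

instance directedSystem_embLERingHom :
    DirectedSystem Trans fun m n h => embLERingHom m n h where
  map_self _ f := embLE_self _ f
  map_map _ _ _ hij hjk f := (Nat.leRecOn_trans hij hjk f).symm

/-- Bridges the limit along the bare functions `embLE` and the injectivity result for directed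
systems of ring homomorphisms. -/
theorem directLimit_of_injective {G : ℕ → Type} [∀ n, CommRing (G n)]
    {f : ∀ m n, m ≤ n → G m → G n} {f' : ∀ m n, m ≤ n → G m →+* G n}
    [DirectedSystem G fun m n h => f' m n h] (hf' : ∀ m n h, f m n h = f' m n h)
    (hf : ∀ m n h, Function.Injective (f m n h)) (n : ℕ) :
    Function.Injective (Ring.DirectLimit.of G f n) := by
  obtain rfl : f = fun m n h => ⇑(f' m n h) := by
    funext m n h
    exact hf' m n h
  exact Ring.DirectLimit.of_injective f' hf n

theorem incl_injective (n : ℕ) : Function.Injective (incl n) :=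
  directLimit_of_injective (G := Trans) (f := embLE) (f' := embLERingHom) (fun _ _ _ => rfl)
    (fun _ _ h => embLE_injective h) n

theorem incl_emb (n : ℕ) (f : Trans n) : incl (n + 1) (emb n f) = incl n f := by
  have h := Ring.DirectLimit.of_f (G := Trans) (f := embLE) n.le_succ f
  rwa [embLE_succ le_rfl, embLE_self] at h

theorem incl_embLE {m n : ℕ} (h : m ≤ n) (f : Trans m) : incl n (embLE m n h f) = incl m f :=
  Ring.DirectLimit.of_f h f

theorem exists_incl_eq (z : LogFree) : ∃ (n : ℕ) (f : Trans n), incl n f = z :=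
  Ring.DirectLimit.exists_of z

theorem exists_incl_eq₂ (z w : LogFree) :
    ∃ (n : ℕ) (f g : Trans n), incl n f = z ∧ incl n g = w := by
  obtain ⟨m, f, rfl⟩ := exists_incl_eq z
  obtain ⟨n, g, rfl⟩ := exists_incl_eq w
  exact ⟨max m n, _, _, incl_embLE (le_max_left m n) f, incl_embLE (le_max_right m n) g⟩

theorem isField_logFree : IsField LogFree where
  exists_pair_ne := ⟨incl 0 0, incl 0 1, (incl_injective 0).ne zero_ne_one⟩
  mul_comm := mul_comm
  mul_inv_cancel {z} hz := by
    obtain ⟨n, f, rfl⟩ := exists_incl_eq z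
    obtain ⟨g, hg⟩ := isField_finGen.mul_inv_cancel (a := f) (by rintro rfl; exact hz (map_zero _))
    exact ⟨incl n g, by rw [← map_mul, hg, map_one]⟩

/-- A compatible family of derivations of the levels extends uniquely to the direct limit. -/
theorem existsUnique_derivation_logFree (D : ∀ n, Derivation ℝ (Trans n) (Trans n))
    (hD : ∀ n f, D (n + 1) (emb n f) = emb n (D n f)) :
    ∃! E : Derivation ℤ LogFree LogFree, ∀ n f, E (incl n f) = incl n (D n f) := by
  have hLE : ∀ (m n : ℕ) (h : m ≤ n) (f : Trans m),
      D n (embLE m n h f) = embLE m n h (D m f) := by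
    intro m n h f
    induction n, h using Nat.le_induction with
    | base => simp only [embLE_self]
    | succ n h ih => simp only [embLE_succ h, hD, ih]
  -- Independence of the representative: both are moved to level `max m n`, where `incl` is
  -- injective.
  have hwd : ∀ {m n : ℕ} {f : Trans m} {g : Trans n}, incl m f = incl n g →
      incl m (D m f) = incl n (D n g) := by
    intro m n f g h
    rw [← incl_embLE (le_max_left m n), ← incl_embLE (le_max_right m n) g] at h
    rw [← incl_embLE (le_max_left m n), ← incl_embLE (le_max_right m n) (D n g), ← hLE, ← hLE,
      incl_injective _ h]
  choose N F hF using exists_incl_eq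
  have hE : ∀ n f, incl (N (incl n f)) (D _ (F (incl n f))) = incl n (D n f) :=
    fun n f => hwd (hF _)
  let E₀ : LogFree →+ LogFree :=
    { toFun := fun z => incl (N z) (D _ (F z))
      map_zero' := by rw [← map_zero (incl 0), hE, map_zero]
      map_add' := fun z w => by
        obtain ⟨n, f, g, rfl, rfl⟩ := exists_incl_eq₂ z w
        rw [← map_add, hE, hE, hE, map_add, map_add] }
  have hE₀ : ∀ n f, E₀ (incl n f) = incl n (D n f) := hE
  refine ⟨Derivation.mk' E₀.toIntLinearMap fun z w => ?_, hE₀, fun E hE' => ?_⟩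
  · obtain ⟨n, f, g, rfl, rfl⟩ := exists_incl_eq₂ z w
    change E₀ _ = _ • E₀ _ + _ • E₀ _
    rw [← map_mul, hE₀, hE₀, hE₀, Derivation.leibniz]
    simp only [smul_eq_mul, map_add, map_mul]
  · ext z
    obtain ⟨n, f, rfl⟩ := exists_incl_eq z
    exact (hE' n f).trans (hE₀ n f).symm

section Series

variable {Γ : Type} [AddCommGroup Γ] [LinearOrder Γ] [IsOrderedAddMonoid Γ]

/-! ### Termwise differentiation with a given logarithmic derivative of the monomials -/

theorem generatedBy_zero (B : Finset Γ) : GeneratedBy B (0 : HahnSeries Γ ℝ) :=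
  ⟨0, by simp⟩

theorem GeneratedBy.of_support_subset {B : Finset Γ} {f g : HahnSeries Γ ℝ}
    (hf : GeneratedBy B f) (h : g.support ⊆ f.support) : GeneratedBy B g := by
  obtain ⟨k, hk⟩ := hf
  exact ⟨k, h.trans hk⟩

theorem GeneratedBy.smul {B : Finset Γ} {f : HahnSeries Γ ℝ} (hf : GeneratedBy B f) (r : ℝ) :
    GeneratedBy B (r • f) :=
  hf.of_support_subset fun x hx h => hx (by simp [h])

theorem generatedBy_sum {B : Finset Γ} {ι : Type} (s : Finset ι) {f : ι → finGen Γ}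
    (h : ∀ i ∈ s, GeneratedBy B (f i : HahnSeries Γ ℝ)) :
    GeneratedBy B ((∑ i ∈ s, f i : finGen Γ) : HahnSeries Γ ℝ) :=
  Finset.sum_induction f (fun f => GeneratedBy B (f : HahnSeries Γ ℝ))
    (fun _ _ => GeneratedBy.add) (generatedBy_zero B) h

theorem generatedBy_of_mem_span {B : Finset Γ} {s : Set (finGen Γ)}
    (hs : ∀ f ∈ s, GeneratedBy B (f : HahnSeries Γ ℝ)) {f : finGen Γ}
    (hf : f ∈ Submodule.span ℝ s) : GeneratedBy B (f : HahnSeries Γ ℝ) := by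
  induction hf using Submodule.span_induction with
  | mem f hf => exact hs f hf
  | zero => exact generatedBy_zero B
  | add f g _ _ hf hg => exact hf.add hg
  | smul r f _ hf => exact hf.smul r

theorem add_mem_grid {B : Finset Γ} {k l : Γ → ℤ} {x y : Γ} (hx : x ∈ grid B k)
    (hy : y ∈ grid B l) : x + y ∈ grid B (k + l) := by
  obtain ⟨m, hm, rfl⟩ := hx
  obtain ⟨n, hn, rfl⟩ := hy
  exact ⟨m + n, fun b hb => add_le_add (hm b hb) (hn b hb), by
    simp [add_smul, Finset.sum_add_distrib]⟩

theorem grid_anti (B : Finset Γ) {k l : Γ → ℤ} (h : k ≤ l) : grid B l ⊆ grid B k := by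
  rintro _ ⟨m, hm, rfl⟩
  exact ⟨m, fun b hb => (h b).trans (hm b hb), rfl⟩

theorem grid_subset_closure (B : Finset Γ) (k : Γ → ℤ) :
    grid B k ⊆ AddSubgroup.closure (B : Set Γ) := by
  rintro _ ⟨m, -, rfl⟩
  exact sum_mem fun b hb => zsmul_mem (AddSubgroup.subset_closure hb) _

/-- Finitely many finitely generated series have their monomials in a common grid. -/
theorem exists_common_grid {ι : Type} (s : Finset ι) (f : ι → finGen Γ) :
    ∃ (B : Finset Γ) (k : Γ → ℤ), (∀ b ∈ B, 0 < b) ∧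
      ∀ i ∈ s, (f i : HahnSeries Γ ℝ).support ⊆ grid B k := by
  classical
  induction s using Finset.induction_on with
  | empty => exact ⟨∅, 0, by simp, by simp⟩
  | insert i s _ ih =>
    obtain ⟨B, k, hB, h⟩ := ih
    obtain ⟨C, hC, l, hl⟩ : FinitelyGenerated (f i : HahnSeries Γ ℝ) := (f i).2
    -- The minimum with `0` admits exponent `0` for generators that occur in only one of the two
    -- sets.
    refine ⟨B ∪ C, fun b => min (min (k b) 0) (min (l b) 0), fun b hb => ?_, fun j hj => ?_⟩
    · exact (Finset.mem_union.mp hb).elim (hB b) (hC b)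
    · rcases Finset.mem_insert.mp hj with rfl | hj
      · exact (hl.trans (grid_subset Finset.subset_union_right l)).trans
          (grid_anti _ fun b => min_le_right _ _)
      · exact ((h j hj).trans (grid_subset Finset.subset_union_left k)).trans
          (grid_anti _ fun b => min_le_left _ _)

/-- Writes convolution as a sum over the monomials of the second factor alone, the index set of
termwise differentiation. A pair with sum `a` is determined by its second entry. -/
theorem coeff_mul_eq_finsum (f g : HahnSeries Γ ℝ) (a : Γ) :
    {m | f.coeff (a - m) * g.coeff m ≠ 0}.Finite ∧
      (f * g).coeff a = ∑ᶠ m, f.coeff (a - m) * g.coeff m := by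
  classical
  have hinj : Set.InjOn (fun p : Γ × Γ => p.2)
      (Finset.antidiagonal f.isPWO_support g.isPWO_support a : Finset (Γ × Γ)) := by
    intro p hp q hq h
    have hp' := (Finset.mem_antidiagonal.mp hp).2.2
    have hq' := (Finset.mem_antidiagonal.mp hq).2.2
    refine Prod.ext ?_ h
    rw [eq_sub_of_add_eq hp', eq_sub_of_add_eq hq']
    exact congrArg (a - ·) h
  have hsub : Function.support (fun m => f.coeff (a - m) * g.coeff m) ⊆
      ((Finset.antidiagonal f.isPWO_support g.isPWO_support a).image Prod.snd : Finset Γ) := by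
    intro m hm
    refine Finset.mem_coe.mpr (Finset.mem_image.mpr ⟨(a - m, m), ?_, rfl⟩)
    exact Finset.mem_antidiagonal.mpr
      ⟨left_ne_zero_of_mul hm, right_ne_zero_of_mul hm, sub_add_cancel _ _⟩
  refine ⟨(Finset.finite_toSet _).subset hsub, ?_⟩
  rw [finsum_eq_sum_of_support_subset _ hsub, Finset.sum_image hinj, HahnSeries.coeff_mul]
  refine Finset.sum_congr rfl fun p hp => ?_
  rw [eq_sub_of_add_eq (Finset.mem_antidiagonal.mp hp).2.2]

/-- A linear map satisfying the Leibniz rule is a derivation. -/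
def derivationOfLeibniz (D : finGen Γ →ₗ[ℝ] finGen Γ)
    (h : ∀ f g, D (f * g) = f * D g + g * D f) : Derivation ℝ (finGen Γ) (finGen Γ) where
  toLinearMap := D
  map_one_eq_zero' := by simpa only [one_mul, left_eq_add] using h 1 1
  leibniz' := h

/-- Multiplication of the coefficient of every monomial `m` by `lam m`. -/
def scaleCoeff (lam : Γ →+ ℝ) (f : HahnSeries Γ ℝ) : HahnSeries Γ ℝ where
  coeff m := lam m * f.coeff m
  isPWO_support' := f.isPWO_support.mono fun _ h => right_ne_zero_of_mul h

theorem support_scaleCoeff_subset (lam : Γ →+ ℝ) (f : HahnSeries Γ ℝ) :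
    (scaleCoeff lam f).support ⊆ f.support := fun _ h => right_ne_zero_of_mul h

/-- Each term of the convolution at `a = p + q` carries the factor `lam a = lam p + lam q`. -/
theorem scaleCoeff_mul (lam : Γ →+ ℝ) (f g : HahnSeries Γ ℝ) :
    scaleCoeff lam (f * g) = f * scaleCoeff lam g + g * scaleCoeff lam f := by
  ext a
  -- Scaling may shrink supports, so all three products are summed over the pairs from the supports
  -- of `f` and `g`.
  rw [HahnSeries.coeff_add, mul_comm g,
    HahnSeries.coeff_mul_right' g.isPWO_support (support_scaleCoeff_subset lam g),
    HahnSeries.coeff_mul_left' f.isPWO_support (support_scaleCoeff_subset lam f),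
    ← Finset.sum_add_distrib]
  change lam a * (f * g).coeff a = _
  rw [HahnSeries.coeff_mul, Finset.mul_sum]
  refine Finset.sum_congr rfl fun p hp => ?_
  rw [← (Finset.mem_antidiagonal.mp hp).2.2, map_add]
  simp only [scaleCoeff]
  ring

/-- Multiplication of the coefficient of every monomial `m` by `lam m`, as a linear map. -/
def scaleLinearMap (lam : Γ →+ ℝ) : finGen Γ →ₗ[ℝ] finGen Γ where
  toFun f := ⟨scaleCoeff lam f, by
    obtain ⟨B, hB, hf⟩ : FinitelyGenerated (f : HahnSeries Γ ℝ) := f.2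
    exact ⟨B, hB, hf.of_support_subset (support_scaleCoeff_subset lam _)⟩⟩
  map_add' f g := Subtype.ext <| HahnSeries.ext <| funext fun m => by
    change lam m * (_ + _) = lam m * _ + lam m * _
    ring
  map_smul' r f := Subtype.ext <| HahnSeries.ext <| funext fun m => by
    change lam m * (r * _) = r * (lam m * _)
    ring

/-- The derivation of finitely generated series multiplying every monomial `m` by `lam m`. -/
def scaleDerivation (lam : Γ →+ ℝ) : Derivation ℝ (finGen Γ) (finGen Γ) :=
  derivationOfLeibniz (scaleLinearMap lam) fun f g =>
    Subtype.ext (scaleCoeff_mul lam f g)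

theorem coeff_scaleDerivation (lam : Γ →+ ℝ) (f : finGen Γ) (m : Γ) :
    (scaleDerivation lam f : HahnSeries Γ ℝ).coeff m =
      lam m * (f : HahnSeries Γ ℝ).coeff m := rfl

/-- An additive map into a real vector space is, on a finitely generated group, a finite sum of
fixed vectors with real additive coefficients. -/
theorem exists_eq_sum_smul {W : Type} [AddCommGroup W] [Module ℝ W] (l : Γ →+ W) (B : Finset Γ) :
    ∃ (n : ℕ) (e : Fin n → W) (lam : Fin n → Γ →+ ℝ),
      (∀ i, e i ∈ Submodule.span ℝ (l '' B)) ∧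
      ∀ m ∈ AddSubgroup.closure (B : Set Γ), l m = ∑ i, lam i m • e i := by
  set V := Submodule.span ℝ (l '' (B : Set Γ))
  have : FiniteDimensional ℝ V := FiniteDimensional.span_of_finite ℝ (B.finite_toSet.image l)
  let b := Module.finBasis ℝ V
  -- The coordinate functionals of `V` are extended to all of `W`, so that composing with `l` gives
  -- additive maps on the whole of `Γ`.
  choose E hE using fun i => LinearMap.exists_extend (b.coord i)
  refine ⟨_, fun i => b i, fun i => (E i).toAddMonoidHom.comp l, fun i => (b i).2, fun m hm => ?_⟩
  have hmV : l m ∈ V := by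
    induction hm using AddSubgroup.closure_induction with
    | mem x hx => exact Submodule.subset_span ⟨x, hx, rfl⟩
    | zero => rw [map_zero]; exact V.zero_mem
    | add x y _ _ hx hy => rw [map_add]; exact V.add_mem hx hy
    | neg x _ hx => rw [map_neg]; exact V.neg_mem hx
  have h := congrArg V.subtype (b.sum_repr ⟨l m, hmV⟩)
  rw [map_sum] at h
  refine h.symm.trans (Finset.sum_congr rfl fun i _ => ?_)
  rw [map_smul]
  congr 1
  exact (LinearMap.congr_fun (hE i) ⟨l m, hmV⟩).symm

theorem coeff_smul_mul_monomialSeries (l : Γ →+ finGen Γ) (c : ℝ) (m g : Γ) :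
    ((c • (l m * monomialSeries m) : finGen Γ) : HahnSeries Γ ℝ).coeff g =
      c * (l m : HahnSeries Γ ℝ).coeff (g - m) := by
  change c * ((l m : HahnSeries Γ ℝ) * HahnSeries.single m 1).coeff g = _
  rw [HahnSeries.coeff_mul_single, mul_one]

theorem IsAsymptoticSum.unique {I : Type} {s : I → finGen Γ} {f g : finGen Γ}
    (hf : IsAsymptoticSum s f) (hg : IsAsymptoticSum s g) : f = g :=
  Subtype.ext <| HahnSeries.ext <| funext fun m => ((hf.2 m).2).trans ((hg.2 m).2).symm

theorem coeff_finGen_sum {ι : Type} (s : Finset ι) (f : ι → finGen Γ) (g : Γ) :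
    ((∑ i ∈ s, f i : finGen Γ) : HahnSeries Γ ℝ).coeff g =
      ∑ i ∈ s, (f i : HahnSeries Γ ℝ).coeff g := by
  rw [AddSubmonoidClass.coe_finsetSum, HahnSeries.coeff_sum]

/-- On the monomials of `f` the identity `hl` splits the family into finitely many, the `i`-th being
the expansion of the product of `e i` with the diagonal derivative of `f`. Finiteness of
contributions is thus inherited from multiplication of Hahn series. -/
theorem isAsymptoticSum_sum_mul_scaleDerivation (l : Γ →+ finGen Γ) {B : Finset Γ}
    (hB : ∀ b ∈ B, 0 < b) {n : ℕ} {e : Fin n → finGen Γ} {lam : Fin n → Γ →+ ℝ}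
    (hl : ∀ m ∈ AddSubgroup.closure (B : Set Γ), l m = ∑ i, lam i m • e i) {f : finGen Γ}
    (hf : GeneratedBy B (f : HahnSeries Γ ℝ)) :
    IsAsymptoticSum (fun m => (f : HahnSeries Γ ℝ).coeff m • (l m * monomialSeries m))
      (∑ i, e i * scaleDerivation (lam i) f) := by
  classical
  obtain ⟨k, hk⟩ := hf
  have hcoeff : ∀ m g, (((f : HahnSeries Γ ℝ).coeff m • (l m * monomialSeries m) : finGen Γ) :
      HahnSeries Γ ℝ).coeff g = ∑ i, (e i : HahnSeries Γ ℝ).coeff (g - m) *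
        (scaleDerivation (lam i) f : HahnSeries Γ ℝ).coeff m := by
    intro m g
    rw [coeff_smul_mul_monomialSeries]
    -- The formula for `l m` holds only in the subgroup generated by `B`; outside the support of `f`
    -- both sides vanish anyway.
    by_cases hm : (f : HahnSeries Γ ℝ).coeff m = 0
    · simp [coeff_scaleDerivation, hm]
    · rw [hl m (grid_subset_closure B k (hk hm)), coeff_finGen_sum, Finset.mul_sum]
      refine Finset.sum_congr rfl fun i _ => ?_
      change _ * (lam i m * (e i : HahnSeries Γ ℝ).coeff (g - m)) = _
      rw [coeff_scaleDerivation]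
      ring
  refine ⟨?_, fun g => ⟨?_, ?_⟩⟩
  · obtain ⟨C, c, hC, hc⟩ := exists_common_grid Finset.univ e
    refine ⟨B ∪ C, (fun b => min (c b) 0) + fun b => min (k b) 0, fun b hb =>
      (Finset.mem_union.mp hb).elim (hB b) (hC b), fun m x hx => ?_⟩
    rw [HahnSeries.mem_support, hcoeff] at hx
    obtain ⟨i, -, hi⟩ := Finset.exists_ne_zero_of_sum_ne_zero hx
    rw [← sub_add_cancel x m]
    refine add_mem_grid (grid_subset Finset.subset_union_right c
      (hc i (Finset.mem_univ i) (left_ne_zero_of_mul hi)))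
      (grid_subset Finset.subset_union_left k (hk ?_))
    exact support_scaleCoeff_subset (lam i) _ (right_ne_zero_of_mul hi)
  · refine (Set.finite_iUnion fun i => (coeff_mul_eq_finsum (e i : HahnSeries Γ ℝ)
      (scaleDerivation (lam i) f : HahnSeries Γ ℝ) g).1).subset fun m hm => ?_
    rw [Set.mem_ofPred_eq, hcoeff] at hm
    obtain ⟨i, -, hi⟩ := Finset.exists_ne_zero_of_sum_ne_zero hm
    exact Set.mem_iUnion.mpr ⟨i, hi⟩
  · rw [coeff_finGen_sum, finsum_congr fun m => hcoeff m g, finsum_sum_comm]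
    · exact Finset.sum_congr rfl fun i _ => (coeff_mul_eq_finsum _ _ g).2
    · exact fun i _ => (coeff_mul_eq_finsum _ _ g).1

theorem exists_isAsymptoticSum (l : Γ →+ finGen Γ) (f : finGen Γ) :
    ∃ F, IsAsymptoticSum
      (fun m => (f : HahnSeries Γ ℝ).coeff m • (l m * monomialSeries m)) F := by
  obtain ⟨B, hB, hf⟩ : FinitelyGenerated (f : HahnSeries Γ ℝ) := f.2
  obtain ⟨n, e, lam, -, hl⟩ := exists_eq_sum_smul (W := finGen Γ) l B
  exact ⟨_, isAsymptoticSum_sum_mul_scaleDerivation l hB hl hf⟩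

/-- Since asymptotic sums are unique, one choice of `e` and `lam` computes the sum for every `f`
generated by `B`. Identities between several series then follow from a common `B`, and the span
condition keeps track of the generators of the `e i`. -/
theorem choose_eq_sum (l : Γ →+ finGen Γ) {B : Finset Γ} (hB : ∀ b ∈ B, 0 < b) :
    ∃ (n : ℕ) (e : Fin n → finGen Γ) (lam : Fin n → Γ →+ ℝ),
      (∀ i, e i ∈ Submodule.span ℝ (l '' B)) ∧
      ∀ f : finGen Γ, GeneratedBy B (f : HahnSeries Γ ℝ) →
        (exists_isAsymptoticSum l f).choose = ∑ i, e i * scaleDerivation (lam i) f := by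
  obtain ⟨n, e, lam, he, hl⟩ := exists_eq_sum_smul (W := finGen Γ) l B
  exact ⟨n, e, lam, he, fun f hf => (exists_isAsymptoticSum l f).choose_spec.unique
    (isAsymptoticSum_sum_mul_scaleDerivation l hB hl hf)⟩

/-- The termwise derivation with `D m = l m * m` for all monomials `m`, as a linear map. -/
def termwiseLinearMap (l : Γ →+ finGen Γ) : finGen Γ →ₗ[ℝ] finGen Γ where
  toFun f := (exists_isAsymptoticSum l f).choose
  map_add' f g := by
    obtain ⟨B, hB, hf, hg⟩ := FinitelyGenerated.common f.2 g.2
    obtain ⟨n, e, lam, -, h⟩ := choose_eq_sum l hB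
    rw [h f hf, h g hg, h (f + g) (hf.add hg), ← Finset.sum_add_distrib]
    exact Finset.sum_congr rfl fun i _ => by rw [map_add, mul_add]
  map_smul' r f := by
    obtain ⟨B, hB, hf⟩ : FinitelyGenerated (f : HahnSeries Γ ℝ) := f.2
    obtain ⟨n, e, lam, -, h⟩ := choose_eq_sum l hB
    rw [h f hf, h (r • f) (hf.smul r), RingHom.id_apply, Finset.smul_sum]
    exact Finset.sum_congr rfl fun i _ => by rw [Derivation.map_smul, mul_smul_comm]

/-- The termwise derivation with `D m = l m * m` for all monomials `m`. -/
def termwiseDerivation (l : Γ →+ finGen Γ) : Derivation ℝ (finGen Γ) (finGen Γ) :=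
  derivationOfLeibniz (termwiseLinearMap l) fun f g => by
    obtain ⟨B, hB, hf, hg⟩ := FinitelyGenerated.common f.2 g.2
    obtain ⟨n, e, lam, -, h⟩ := choose_eq_sum l hB
    change (exists_isAsymptoticSum l (f * g)).choose =
      f * (exists_isAsymptoticSum l g).choose + g * (exists_isAsymptoticSum l f).choose
    rw [h f hf, h g hg, h (f * g) (hf.mul hg), Finset.mul_sum, Finset.mul_sum,
      ← Finset.sum_add_distrib]
    refine Finset.sum_congr rfl fun i _ => ?_
    rw [Derivation.leibniz, smul_eq_mul, smul_eq_mul]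
    ring

theorem isAsymptoticSum_termwiseDerivation (l : Γ →+ finGen Γ) (f : finGen Γ) :
    IsAsymptoticSum (fun m => (f : HahnSeries Γ ℝ).coeff m • (l m * monomialSeries m))
      (termwiseDerivation l f) :=
  (exists_isAsymptoticSum l f).choose_spec

theorem coeff_termwiseDerivation (l : Γ →+ finGen Γ) (f : finGen Γ) (g : Γ) :
    (termwiseDerivation l f : HahnSeries Γ ℝ).coeff g =
      ∑ᶠ m, (f : HahnSeries Γ ℝ).coeff m * (l m : HahnSeries Γ ℝ).coeff (g - m) :=
  ((isAsymptoticSum_termwiseDerivation l f).2 g).2.trans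
    (finsum_congr fun m => coeff_smul_mul_monomialSeries l _ m g)

theorem termwiseDerivation_monomialSeries (l : Γ →+ finGen Γ) (m : Γ) :
    termwiseDerivation l (monomialSeries m) = l m * monomialSeries m := by
  refine Subtype.ext <| HahnSeries.ext <| funext fun g => ?_
  rw [coeff_termwiseDerivation, finsum_eq_single _ m]
  · change (HahnSeries.single m (1 : ℝ)).coeff m * _ =
      ((l m : HahnSeries Γ ℝ) * HahnSeries.single m 1).coeff g
    rw [HahnSeries.coeff_mul_single, HahnSeries.coeff_single_same, one_mul, mul_one]
  · intro m' hm'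
    change (HahnSeries.single m (1 : ℝ)).coeff m' * _ = 0
    rw [HahnSeries.coeff_single_of_ne hm', zero_mul]

/-- In the finite formula the `e i` are real combinations of the `l b` with `b ∈ B`, and diagonal
derivations do not enlarge supports. -/
theorem GeneratedBy.termwiseDerivation {l : Γ →+ finGen Γ} {B C : Finset Γ}
    (hB : ∀ b ∈ B, 0 < b) (hBC : B ⊆ C) (hl : ∀ b ∈ B, GeneratedBy C (l b : HahnSeries Γ ℝ))
    {f : finGen Γ} (hf : GeneratedBy B (f : HahnSeries Γ ℝ)) :
    GeneratedBy C (termwiseDerivation l f : HahnSeries Γ ℝ) := by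
  obtain ⟨n, e, lam, he, h⟩ := choose_eq_sum l hB
  have hD : Transseries.termwiseDerivation l f = ∑ i, e i * scaleDerivation (lam i) f := h f hf
  rw [hD]
  refine generatedBy_sum _ fun i _ => GeneratedBy.mul ?_ ?_
  · exact generatedBy_of_mem_span (by rintro _ ⟨b, hb, rfl⟩; exact hl b hb) (he i)
  · exact (hf.mono hBC).of_support_subset (support_scaleCoeff_subset (lam i) f)

/-! ### Compatibility of termwise derivations with embeddings -/

variable {Γ' : Type} [AddCommGroup Γ'] [LinearOrder Γ'] [IsOrderedAddMonoid Γ']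

theorem coeff_finGenMap (e : Γ →+o Γ') (he : Function.Injective e) (f : finGen Γ) (g : Γ) :
    (finGenMap e he f : HahnSeries Γ' ℝ).coeff (e g) = (f : HahnSeries Γ ℝ).coeff g :=
  HahnSeries.embDomain_coeff (f := orderEmb e he)

theorem coeff_finGenMap_of_notMem_range (e : Γ →+o Γ') (he : Function.Injective e) (f : finGen Γ)
    {g : Γ'} (hg : g ∉ Set.range e) : (finGenMap e he f : HahnSeries Γ' ℝ).coeff g = 0 :=
  HahnSeries.embDomain_of_notMem_range (f := orderEmb e he) hg

/-- Termwise derivations are compatible with embeddings that preserve the logarithmic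
derivatives of the monomials. -/
theorem termwiseDerivation_finGenMap (e : Γ →+o Γ') (he : Function.Injective e)
    {l : Γ →+ finGen Γ} {l' : Γ' →+ finGen Γ'} (h : ∀ m, l' (e m) = finGenMap e he (l m))
    (f : finGen Γ) :
    termwiseDerivation l' (finGenMap e he f) = finGenMap e he (termwiseDerivation l f) := by
  refine Subtype.ext <| HahnSeries.ext <| funext fun g => ?_
  rw [coeff_termwiseDerivation]
  -- Only embedded monomials occur in the embedded series, so the sum over `Γ'` becomes a sum over
  -- `Γ`.
  have hrange : Function.support (fun m => (finGenMap e he f : HahnSeries Γ' ℝ).coeff m *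
      (l' m : HahnSeries Γ' ℝ).coeff (g - m)) ⊆ Set.range e := by
    intro m hm
    by_contra hm'
    exact hm (by simp only [coeff_finGenMap_of_notMem_range e he f hm', zero_mul])
  rw [← finsum_mem_univ, ← finsum_mem_inter_support, Set.univ_inter,
    ← Set.inter_eq_right.mpr hrange, finsum_mem_inter_support, finsum_mem_range he]
  simp only [h, coeff_finGenMap]
  by_cases hg : g ∈ Set.range e
  · obtain ⟨g, rfl⟩ := hg
    rw [coeff_finGenMap, coeff_termwiseDerivation]
    simp only [← map_sub, coeff_finGenMap]
  · rw [coeff_finGenMap_of_notMem_range e he _ hg]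
    -- The range is a subgroup: if `g` is outside it, so is `g - e m`, where the embedded series `l
    -- m` has no coefficient.
    refine finsum_eq_zero_of_forall_eq_zero fun m => ?_
    rw [coeff_finGenMap_of_notMem_range e he _ (g := g - e m), mul_zero]
    rintro ⟨x, hx⟩
    exact hg ⟨x + m, by rw [map_add, hx, sub_add_cancel]⟩

end Series

/-! ### Embeddings of transmonomials -/

theorem eq_powExp {n : ℕ} (m : Mon (n + 1)) : ∃ σ L, m = powExp (n := n) σ L := ⟨_, _, rfl⟩

theorem powExp_inj {n : ℕ} {σ τ : ℝ} {L L' : LargeTrans n} (h : powExp σ L = powExp τ L') :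
    σ = τ ∧ L = L' :=
  have h' : (L, σ) = (L', τ) :=
    congrArg (fun z : (LargeTrans n ×ₗ ℝ)ᵒᵈ => ofLex (OrderDual.ofDual z)) h
  ⟨congrArg Prod.snd h', congrArg Prod.fst h'⟩

theorem powExp_add {n : ℕ} (σ τ : ℝ) (L L' : LargeTrans n) :
    powExp (σ + τ) (L + L') = powExp σ L + powExp τ L' := rfl

theorem pow_neg_one_pos : ∀ n, 0 < pow n (-1)
  | 0 => OrderDual.toDual_lt_toDual.mpr (neg_one_lt_zero (R := ℝ))
  | _ + 1 => (powExp_lt_powExp _ _ _ _).mpr (Or.inr ⟨rfl, neg_one_lt_zero⟩)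

theorem monEmb_injective (n : ℕ) : Function.Injective (monEmb n) := (monEmbAux n).2

theorem monEmb_pos {n : ℕ} {b : Mon n} (hb : 0 < b) : 0 < monEmb n b := by
  simpa using (monEmb n).monotone'.strictMono_of_injective (monEmb_injective n) hb

theorem emb_monomialSeries (n : ℕ) (m : Mon n) :
    emb n (monomialSeries m) = monomialSeries (monEmb n m) :=
  Subtype.ext (HahnSeries.embDomain_single (f := orderEmb (monEmb n) (monEmb_injective n)))

/-- The embedding of the large transseries of level `n` into those of level `n + 1`. -/
def largeEmb (n : ℕ) : LargeTrans n →+ LargeTrans (n + 1) :=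
  largeMap (monEmb n) (monEmb_injective n)

theorem largeToSeries_largeEmb {n : ℕ} (L : LargeTrans n) :
    largeToSeries (largeEmb n L) = emb n (largeToSeries L) := rfl

theorem monEmb_zero (σ : Mon 0) : monEmb 0 σ = powExp (OrderDual.ofDual σ : ℝ) 0 := rfl

theorem monEmb_powExp {n : ℕ} (σ : ℝ) (L : LargeTrans n) :
    monEmb (n + 1) (powExp σ L) = powExp σ (largeEmb n L) := rfl

theorem monEmb_pow : ∀ (n : ℕ) (σ : ℝ), monEmb n (pow n σ) = pow (n + 1) σ
  | 0, _ => rfl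
  | n + 1, σ => (monEmb_powExp σ 0).trans (congrArg (powExp σ) (map_zero (largeEmb n)))

theorem monomialSeries_add {Γ : Type} [AddCommGroup Γ] [LinearOrder Γ] [IsOrderedAddMonoid Γ]
    (a b : Γ) : monomialSeries (a + b) = monomialSeries a * monomialSeries b := by
  refine Subtype.ext ?_
  change HahnSeries.single (a + b) (1 : ℝ) = HahnSeries.single a 1 * HahnSeries.single b 1
  rw [HahnSeries.single_mul_single, one_mul]

theorem largeToSeries_zero {Γ : Type} [AddCommGroup Γ] [LinearOrder Γ] [IsOrderedAddMonoid Γ] :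
    largeToSeries (0 : large Γ) = 0 := rfl

theorem largeToSeries_add {Γ : Type} [AddCommGroup Γ] [LinearOrder Γ] [IsOrderedAddMonoid Γ]
    (L L' : large Γ) : largeToSeries (L + L') = largeToSeries L + largeToSeries L' := rfl

/-! ### The derivations of the levels -/

/-- The logarithmic derivative of the real powers. -/
def logDerivZero : Mon 0 →+ Trans 0 where
  toFun σ := (OrderDual.ofDual σ : ℝ) • monomialSeries (pow 0 (-1))
  map_zero' := zero_smul ℝ _
  map_add' _ _ := add_smul (_ : ℝ) (_ : ℝ) _

/-- The logarithmic derivative of the transmonomials of level `n + 1` that belongs to a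
derivation of the transseries of level `n`. -/
def logDerivSucc (n : ℕ) (D : Derivation ℝ (Trans n) (Trans n)) : Mon (n + 1) →+ Trans (n + 1) where
  toFun m := ((ofLex (OrderDual.ofDual m : LargeTrans n ×ₗ ℝ)).2 : ℝ) •
      monomialSeries (pow (n + 1) (-1)) +
    emb n (D (largeToSeries (ofLex (OrderDual.ofDual m : LargeTrans n ×ₗ ℝ)).1))
  map_zero' := by
    change (0 : ℝ) • monomialSeries (pow (n + 1) (-1)) +
      emb n (D (largeToSeries (0 : LargeTrans n))) = 0
    rw [largeToSeries_zero, map_zero, map_zero, zero_smul, add_zero]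
  map_add' a b := by
    obtain ⟨σ, L, rfl⟩ := eq_powExp a
    obtain ⟨τ, L', rfl⟩ := eq_powExp b
    change (σ + τ) • monomialSeries (pow (n + 1) (-1)) + emb n (D (largeToSeries (L + L'))) =
      (σ • monomialSeries (pow (n + 1) (-1)) + emb n (D (largeToSeries L))) +
      (τ • monomialSeries (pow (n + 1) (-1)) + emb n (D (largeToSeries L')))
    rw [largeToSeries_add, map_add, map_add, add_smul]
    abel

/-- The logarithmic derivative of the transmonomials of level `n`. -/
def logDeriv : (n : ℕ) → Mon n →+ Trans n
  | 0 => logDerivZero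
  | n + 1 => logDerivSucc n (termwiseDerivation (logDeriv n))

/-- The derivation of the transseries of level `n`. -/
def transDerivation (n : ℕ) : Derivation ℝ (Trans n) (Trans n) := termwiseDerivation (logDeriv n)

theorem logDeriv_pow_zero (σ : ℝ) : logDeriv 0 (pow 0 σ) = σ • monomialSeries (pow 0 (-1)) := rfl

theorem logDeriv_powExp {n : ℕ} (σ : ℝ) (L : LargeTrans n) :
    logDeriv (n + 1) (powExp σ L) = σ • monomialSeries (pow (n + 1) (-1)) +
      emb n (transDerivation n (largeToSeries L)) := rfl

theorem transDerivation_monomialSeries {n : ℕ} (m : Mon n) :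
    transDerivation n (monomialSeries m) = logDeriv n m * monomialSeries m :=
  termwiseDerivation_monomialSeries _ m

theorem pow_zero_add (σ τ : ℝ) : pow 0 (σ + τ) = pow 0 σ + pow 0 τ := rfl

theorem isTermwiseDifferentiation_transDerivation :
    IsTermwiseDifferentiation fun n => transDerivation n where
  pow σ := by
    rw [transDerivation_monomialSeries, logDeriv_pow_zero, smul_mul_assoc, ← monomialSeries_add,
      ← pow_zero_add, neg_add_eq_sub]
  powExp n σ L := by
    have h : powExp (σ - 1) L = pow (n + 1) (-1) + powExp σ L := by
      change _ = powExp (-1) 0 + powExp σ L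
      rw [← powExp_add, zero_add, neg_add_eq_sub]
    rw [transDerivation_monomialSeries, logDeriv_powExp, h, monomialSeries_add, add_mul,
      smul_mul_assoc]
  series n f := by
    have h := isAsymptoticSum_termwiseDerivation (logDeriv n) f
    simp only [← transDerivation_monomialSeries] at h
    exact h

/-- At each level the values on monomials determine the map, by uniqueness of asymptotic sums; on
monomials of level `n + 1` these are prescribed by the map at level `n`. -/
theorem IsTermwiseDifferentiation.unique {D D' : ∀ n, Trans n → Trans n}
    (hD : IsTermwiseDifferentiation D) (hD' : IsTermwiseDifferentiation D') (n : ℕ) :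
    D n = D' n := by
  have series : ∀ n, (∀ m, D n (monomialSeries m) = D' n (monomialSeries m)) → D n = D' n := by
    intro n h
    funext f
    have h₁ := hD.series n f
    simp only [h] at h₁
    exact h₁.unique (hD'.series n f)
  induction n with
  | zero => exact series 0 fun σ => (hD.pow σ).trans (hD'.pow σ).symm
  | succ n ih =>
    refine series (n + 1) fun m => ?_
    obtain ⟨σ, L, rfl⟩ := eq_powExp m
    rw [hD.powExp, hD'.powExp, ih]

/-- The exponent of an embedded monomial is the embedded exponent, so the inductive step needs the
derivations to commute with `emb` one level below. This is `termwiseDerivation_finGenMap` applied to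
the induction hypothesis. At level `0` the exponent is zero. -/
theorem logDeriv_monEmb (n : ℕ) (m : Mon n) :
    logDeriv (n + 1) (monEmb n m) = emb n (logDeriv n m) := by
  induction n with
  | zero =>
    rw [monEmb_zero, logDeriv_powExp, largeToSeries_zero, map_zero, map_zero, add_zero,
      ← monEmb_pow, ← emb_monomialSeries, ← map_smul]
    rfl
  | succ n ih =>
    obtain ⟨σ, L, rfl⟩ := eq_powExp m
    have hD : transDerivation (n + 1) (emb n (largeToSeries L)) =
        emb n (transDerivation n (largeToSeries L)) := termwiseDerivation_finGenMap _ _ ih _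
    rw [monEmb_powExp, logDeriv_powExp, logDeriv_powExp, largeToSeries_largeEmb, hD, map_add,
      map_smul, emb_monomialSeries, monEmb_pow]

theorem transDerivation_emb (n : ℕ) (f : Trans n) :
    transDerivation (n + 1) (emb n f) = emb n (transDerivation n f) :=
  termwiseDerivation_finGenMap _ _ (logDeriv_monEmb n) f

/-! ### Generating systems -/

section Series

variable {Γ : Type} [AddCommGroup Γ] [LinearOrder Γ] [IsOrderedAddMonoid Γ]
variable {Γ' : Type} [AddCommGroup Γ'] [LinearOrder Γ'] [IsOrderedAddMonoid Γ']

theorem generatedBy_monomialSeries {B : Finset Γ} {b : Γ} (hb : b ∈ B) :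
    GeneratedBy B (monomialSeries b : HahnSeries Γ ℝ) := by
  refine ⟨0, fun x hx => closure_subset_grid B (AddSubmonoid.subset_closure ?_)⟩
  rwa [Set.mem_singleton_iff.mp (HahnSeries.support_single_subset hx)]

theorem GeneratedBy.finGenMap [DecidableEq Γ'] (e : Γ →+o Γ') (he : Function.Injective e)
    {B : Finset Γ} {f : finGen Γ} (hf : GeneratedBy B (f : HahnSeries Γ ℝ)) :
    GeneratedBy (B.image e) (finGenMap e he f : HahnSeries Γ' ℝ) := by
  obtain ⟨k₀, hk⟩ := hf
  refine ⟨Function.extend e k₀ 0, fun x hx => ?_⟩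
  obtain ⟨g, hg, rfl⟩ := HahnSeries.support_embDomain_subset (f := orderEmb e he) hx
  obtain ⟨k, hk', rfl⟩ := hk hg
  -- Exponents are transported along the injective `e`; the default `0` is never used on `B.image
  -- e`.
  refine ⟨Function.extend e k 0, fun b hb => ?_, ?_⟩
  · obtain ⟨a, ha, rfl⟩ := Finset.mem_image.mp hb
    simpa [he.extend_apply] using hk' a ha
  · rw [Finset.sum_image fun _ _ _ _ h => he h]
    change e _ = _
    rw [map_sum]
    exact Finset.sum_congr rfl fun a _ => by rw [he.extend_apply, map_zsmul]

end Series

theorem IsGeneratingSystem.pos : ∀ {n : ℕ} {f : Trans n} {B : Finset (Mon n)},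
    IsGeneratingSystem n f B → ∀ b ∈ B, 0 < b
  | 0, _, _, h => h.1
  | _ + 1, _, _, h => h.1

theorem IsGeneratingSystem.generatedBy : ∀ {n : ℕ} {f : Trans n} {B : Finset (Mon n)},
    IsGeneratingSystem n f B → GeneratedBy B (f : HahnSeries (Mon n) ℝ)
  | 0, _, _, h => h.2
  | _ + 1, _, _, h => h.2.1

/-- Systems for the exponents must be raised one level too, which makes this an induction; real
powers of level `0` acquire exponent zero and impose no condition. -/
theorem IsGeneratingSystem.emb {n : ℕ} {f : Trans n} {B : Finset (Mon n)}
    (h : IsGeneratingSystem n f B) :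
    IsGeneratingSystem (n + 1) (emb n f) (B.image (monEmb n)) := by
  refine ⟨fun b hb => ?_, h.generatedBy.finGenMap _ (monEmb_injective n), ?_⟩
  · obtain ⟨a, ha, rfl⟩ := Finset.mem_image.mp hb
    exact monEmb_pos (h.pos a ha)
  intro σ L hL hL0
  obtain ⟨a, ha, haL⟩ := Finset.mem_image.mp hL
  induction n generalizing σ with
  | zero =>
    rw [monEmb_zero] at haL
    exact absurd (powExp_inj haL).2.symm hL0
  | succ n ih =>
    obtain ⟨τ, L', rfl⟩ := eq_powExp a
    rw [monEmb_powExp] at haL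
    obtain ⟨-, rfl⟩ := powExp_inj haL
    obtain ⟨B', hB', hsub⟩ := h.2.2 τ L' ha fun h0 => hL0 (by rw [h0, map_zero])
    -- The image of a system for `L'` serves for its embedded copy; the requirement on exponents
    -- inside it is the induction hypothesis for `B'`.
    refine ⟨B'.image (monEmb n), ⟨fun b hb => ?_,
      hB'.generatedBy.finGenMap _ (monEmb_injective n), fun σ L hL hL0 => ?_⟩, fun b hb => ?_⟩
    · obtain ⟨a, ha, rfl⟩ := Finset.mem_image.mp hb
      exact monEmb_pos (hB'.pos a ha)
    · obtain ⟨a, ha, haL⟩ := Finset.mem_image.mp hL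
      exact ih hB' σ L hL hL0 a ha haL
    · obtain ⟨a, ha, rfl⟩ := Finset.mem_image.mp hb
      exact Finset.mem_image_of_mem _ (hsub a ha)

/-- Every finite set of small transmonomials generating `f` is contained in a generating system
of all levels. -/
theorem exists_isGeneratingSystem_superset {n : ℕ} {f : Trans n} {B : Finset (Mon n)}
    (hB : ∀ b ∈ B, 0 < b) (hf : GeneratedBy B (f : HahnSeries (Mon n) ℝ)) :
    ∃ B', B ⊆ B' ∧ IsGeneratingSystem n f B' := by
  induction n with
  | zero => exact ⟨B, subset_rfl, hB, hf⟩
  | succ n ih =>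
    have hex : ∀ L : LargeTrans n, ∃ C, IsGeneratingSystem n (largeToSeries L) C := by
      intro L
      obtain ⟨C, hC, hL⟩ : FinitelyGenerated (largeToSeries L : HahnSeries (Mon n) ℝ) :=
        (largeToSeries L).2
      obtain ⟨C', -, hC'⟩ := ih hC hL
      exact ⟨C', hC'⟩
    choose C hC using hex
    let E : Mon (n + 1) → LargeTrans n := fun m => (ofLex (OrderDual.ofDual m : LargeTrans n ×ₗ ℝ)).1
    -- Adjoin, for every `b ∈ B`, the embedded generating system of its exponent. Exponents of the
    -- new elements need nothing more, since each embedded system is already closed.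
    refine ⟨B ∪ B.biUnion fun b => (C (E b)).image (monEmb n), Finset.subset_union_left,
      fun b hb => ?_, hf.mono Finset.subset_union_left, fun σ L hL hL0 => ?_⟩
    · rcases Finset.mem_union.mp hb with hb | hb
      · exact hB b hb
      · obtain ⟨c, -, hbc⟩ := Finset.mem_biUnion.mp hb
        exact (hC (E c)).emb.pos b hbc
    · rcases Finset.mem_union.mp hL with hL | hL
      · exact ⟨C L, hC L, fun b hb => Finset.mem_union_right _
          (Finset.mem_biUnion.mpr ⟨_, hL, Finset.mem_image_of_mem _ hb⟩)⟩
      · obtain ⟨c, hcB, hLc⟩ := Finset.mem_biUnion.mp hL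
        obtain ⟨B', hB', hsub⟩ := (hC (E c)).emb.2.2 σ L hLc hL0
        exact ⟨B', hB', fun b hb => Finset.mem_union_right _
          (Finset.mem_biUnion.mpr ⟨c, hcB, hsub b hb⟩)⟩

/-- A generating system of `f`, together with `x⁻¹`, is a generating system of the derivative. -/
theorem IsGeneratingSystem.transDerivation {n : ℕ} {f : Trans n} {B : Finset (Mon n)}
    (h : IsGeneratingSystem n f B) :
    IsGeneratingSystem n (transDerivation n f) (insert (pow n (-1)) B) := by
  have hpos : ∀ b ∈ insert (pow n (-1)) B, 0 < b := fun b hb =>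
    (Finset.mem_insert.mp hb).elim (fun hb => hb ▸ pow_neg_one_pos n) (h.pos b)
  have hx : ∀ σ : ℝ, GeneratedBy (insert (pow n (-1)) B)
      ((σ • monomialSeries (pow n (-1)) : Trans n) : HahnSeries (Mon n) ℝ) := fun σ =>
    (generatedBy_monomialSeries (Finset.mem_insert_self _ _)).smul σ
  induction n with
  | zero =>
    exact ⟨hpos, h.generatedBy.termwiseDerivation h.pos (Finset.subset_insert _ _)
      fun σ _ => hx (OrderDual.ofDual σ : ℝ)⟩
  | succ n ih =>
    refine ⟨hpos, h.generatedBy.termwiseDerivation h.pos (Finset.subset_insert _ _) ?_, ?_⟩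
    · intro b hb
      obtain ⟨σ, L, rfl⟩ := eq_powExp b
      rw [logDeriv_powExp]
      refine (hx σ).add ?_
      by_cases hL0 : L = 0
      · rw [hL0, largeToSeries_zero, map_zero, map_zero]
        exact generatedBy_zero _
      · obtain ⟨B', hB', hsub⟩ := h.2.2 σ L hb hL0
        have hpos' : ∀ b ∈ insert (pow n (-1)) B', 0 < b := fun b hb =>
          (Finset.mem_insert.mp hb).elim (fun hb => hb ▸ pow_neg_one_pos n) (hB'.pos b)
        -- By induction `B'` and `x⁻¹` generate the derivative of the exponent `L`, and their images
        -- lie in `B ∪ {x⁻¹}`.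
        have hD := ih hB' hpos' fun σ =>
          (generatedBy_monomialSeries (Finset.mem_insert_self _ _)).smul σ
        refine (hD.generatedBy.finGenMap _ (monEmb_injective n)).mono fun c hc => ?_
        obtain ⟨a, ha, rfl⟩ := Finset.mem_image.mp hc
        rcases Finset.mem_insert.mp ha with rfl | ha
        · rw [monEmb_pow]
          exact Finset.mem_insert_self _ _
        · exact Finset.mem_insert_of_mem (hsub a ha)
    · intro σ L hL hL0
      rcases Finset.mem_insert.mp hL with hL | hL
      -- The added generator `x⁻¹` has exponent zero and so imposes no condition.
      · exact absurd (powExp_inj hL).2 hL0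
      · obtain ⟨B', hB', hsub⟩ := h.2.2 σ L hL hL0
        exact ⟨B', hB', fun b hb => Finset.mem_insert_of_mem (hsub b hb)⟩

end

end Transseries

theorem mainTheorem4 :
    (∀ n : ℕ, IsField (Transseries.Trans n)) ∧
    IsField Transseries.LogFree ∧
    ∃ D : ∀ n : ℕ, Derivation ℝ (Transseries.Trans n) (Transseries.Trans n),
      Transseries.IsTermwiseDifferentiation (fun n => D n) ∧
      (∀ D' : ∀ n : ℕ, Transseries.Trans n → Transseries.Trans n,
        Transseries.IsTermwiseDifferentiation D' → ∀ n, D' n = D n) ∧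
      (∀ (n : ℕ) (f : Transseries.Trans n),
        D (n + 1) (Transseries.emb n f) = Transseries.emb n (D n f)) ∧
      (∃! E : Derivation ℤ Transseries.LogFree Transseries.LogFree,
        ∀ (n : ℕ) (f : Transseries.Trans n),
          E (Transseries.incl n f) = Transseries.incl n (D n f)) ∧
      (∀ (n : ℕ) (f : Transseries.Trans n) (B : Finset (Transseries.Mon n)),
        (∀ b ∈ B, 0 < b) →
        Transseries.GeneratedBy B (f : HahnSeries (Transseries.Mon n) ℝ) →
        ∃ B' : Finset (Transseries.Mon n), B ⊆ B' ∧ Transseries.IsGeneratingSystem n f B') ∧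
      (∀ (n : ℕ) (f : Transseries.Trans n) (B : Finset (Transseries.Mon n)),
        Transseries.IsGeneratingSystem n f B →
        Transseries.IsGeneratingSystem n (D n f) (insert (Transseries.pow n (-1)) B)) :=
  ⟨fun _ => Transseries.isField_finGen, Transseries.isField_logFree,
    Transseries.transDerivation, Transseries.isTermwiseDifferentiation_transDerivation,
    fun _ hD' => hD'.unique Transseries.isTermwiseDifferentiation_transDerivation,
    Transseries.transDerivation_emb,
    Transseries.existsUnique_derivation_logFree _ Transseries.transDerivation_emb,
    fun _ _ _ => Transseries.exists_isGeneratingSystem_superset,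
    fun _ _ _ h => h.transDerivation⟩
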